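/- All local rings are Noetherian and all modules are finitely generated. A local ring $R$ is Cohen–Macaulay (CM) if $\operatorname{depth} R=\dim R$, and an $R$-module $M$ over a CM local ring is called CM (that is, maximal Cohen–Macaulay) if $M=0$ or $\operatorname{depth}_R M=\dim R$. Let $\Omega\mathrm{CM}^{\times}(R)$ be the class of CM $R$-modules $M$ that are isomorphic to the kernel of an epimorphism from a finitely generated free $R$-module to a CM $R$-module and that have no nonzero free direct summand. Let $R\to S$ be a faithfully flat homomorphism of CM local rings and let $M$ be a CM $R$-module. Then $M\in\Omega\mathrm{CM}^{\times}(R)$ if and only if $M\otimes_R S\in\Omega\mathrm{CM}^{\times}(S)$. -/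

import Mathlib

universe u

/-- The depth of a module `M` over a local ring `R`: the supremum of the lengths of the `M`-regular
sequences of elements of the maximal ideal (so the zero module, which has no regular sequence at
all, gets the value `0` here; it is treated separately below). -/
noncomputable def localDepth (R : Type*) [CommRing R] [IsLocalRing R]
    (M : Type*) [AddCommGroup M] [Module R M] : ℕ∞ :=
  ⨆ rs : {rs : List R // (∀ r ∈ rs, r ∈ IsLocalRing.maximalIdeal R) ∧
    RingTheory.Sequence.IsRegular M rs}, (rs.1.length : ℕ∞)

/-- A Cohen-Macaulay local ring: a Noetherian local ring whose depth equals its Krull dimension. -/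
class IsCMLocalRing (R : Type*) [CommRing R] : Prop extends IsLocalRing R, IsNoetherianRing R where
  depth_eq_dim : ((localDepth R R : ℕ∞) : WithBot ℕ∞) = ringKrullDim R

/-- A finitely generated module over a local ring `R` is (maximal) Cohen-Macaulay if it is zero or
its depth equals the Krull dimension of `R`. -/
def IsMCM (R : Type*) [CommRing R] [IsLocalRing R]
    (M : Type*) [AddCommGroup M] [Module R M] : Prop :=
  Module.Finite R M ∧
    (Subsingleton M ∨ ((localDepth R M : ℕ∞) : WithBot ℕ∞) = ringKrullDim R)

/-- Membership in `ΩCM(R)`: `M` is Cohen-Macaulay and is isomorphic to the kernel of an epimorphism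
from a finitely generated free module to a Cohen-Macaulay module. -/
def IsSyzygyOfMCM (R : Type u) [CommRing R] [IsLocalRing R]
    (M : Type*) [AddCommGroup M] [Module R M] : Prop :=
  IsMCM R M ∧
    ∃ (n : ℕ) (N : Type u) (_ : AddCommGroup N) (_ : Module R N) (p : (Fin n → R) →ₗ[R] N),
      IsMCM R N ∧ Function.Surjective p ∧ Nonempty (M ≃ₗ[R] LinearMap.ker p)

/-- `M` has a nonzero free direct summand. -/
def HasNonzeroFreeSummand (R : Type*) [CommRing R]
    (M : Type*) [AddCommGroup M] [Module R M] : Prop :=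
  ∃ P Q : Submodule R M, IsCompl P Q ∧ P ≠ ⊥ ∧ Module.Free R P

/-- Membership in `ΩCM^×(R)`: `M` is in `ΩCM(R)` and has no nonzero free direct summand. -/
def IsOCMS (R : Type*) [CommRing R] [IsLocalRing R]
    (M : Type*) [AddCommGroup M] [Module R M] : Prop :=
  IsSyzygyOfMCM R M ∧ ¬ HasNonzeroFreeSummand R M

/-!
Call `k` the residue field of `R`. If `R → S` is flat and local, then a sequence in `S` that is
regular on `S ⊗ k` is regular on `S ⊗ M`, by Krull's intersection theorem; dividing out an
`M`-regular sequence one obtains `depth (S ⊗ M) = depth M + depth (S ⊗ k)`, so being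
Cohen-Macaulay ascends and descends.

Let `s₁, …, sₙ` generate the dual of `M`. Every map from `M` to a free module factors through
`s : M → Rⁿ`. If `M` embeds in a free module `G` with Cohen-Macaulay cokernel, then `s` is
injective, and comparing the connecting maps of `0 → M → Rⁿ` and `0 → M → G` on `Ext(k, -)` shows
that `coker s` is Cohen-Macaulay too. Hence `M` is a syzygy of a Cohen-Macaulay module iff `M` is
Cohen-Macaulay and `s` is injective with Cohen-Macaulay cokernel. The functionals `S ⊗ sⱼ` generate
the dual of `S ⊗ M`, so this condition ascends and descends. Finally, `M` has a nonzero free summand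
iff the `sⱼ` do not all take values in the maximal ideal, and this is unaffected by base change.
-/

open IsLocalRing RingTheory.Sequence CategoryTheory Abelian
open scoped Pointwise

section Depth

universe v

variable {R : Type u} [CommRing R] [IsLocalRing R]

lemma localDepth_congr {M N : Type*} [AddCommGroup M] [Module R M] [AddCommGroup N] [Module R N]
    (e : M ≃ₗ[R] N) : localDepth R M = localDepth R N := by
  simp only [localDepth, iSup_subtype, e.isRegular_congr]

section

variable {M : Type*} [AddCommGroup M] [Module R M] [Module.Finite R M] [Nontrivial M]

lemma length_le_localDepth {rs : List R} (hmem : ∀ r ∈ rs, r ∈ maximalIdeal R)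
    (hreg : IsWeaklyRegular M rs) : rs.length ≤ localDepth R M :=
  le_iSup (fun rs : {rs : List R // (∀ r ∈ rs, r ∈ maximalIdeal R) ∧ IsRegular M rs} =>
    (rs.1.length : ℕ∞)) ⟨rs, hmem, .of_isWeaklyRegular_of_mem_maximalIdeal M hmem hreg⟩

lemma natCast_le_localDepth_iff {n : ℕ} :
    n ≤ localDepth R M ↔
      ∃ rs : List R, rs.length = n ∧ (∀ r ∈ rs, r ∈ maximalIdeal R) ∧ IsRegular M rs := by
  refine ⟨fun h => ?_, ?_⟩
  · obtain rfl | hn := eq_or_ne n 0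
    · exact ⟨[], rfl, by simp, .nil R M⟩
    obtain ⟨⟨rs, hmem, hreg⟩, hlt⟩ := lt_iSup_iff.1 <|
      (Nat.cast_lt.2 (Nat.pred_lt hn)).trans_le h
    have hlen : n ≤ rs.length := Nat.le_of_pred_lt (Nat.cast_lt.1 hlt)
    have hmem' (r) (hr : r ∈ rs.take n) : r ∈ maximalIdeal R := hmem r (List.mem_of_mem_take hr)
    have hreg' : IsWeaklyRegular M (rs.take n ++ rs.drop n) := by
      rw [List.take_append_drop]
      exact hreg.toIsWeaklyRegular
    exact ⟨rs.take n, by simpa using hlen, hmem', .of_isWeaklyRegular_of_mem_maximalIdeal M hmem'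
      ((isWeaklyRegular_append_iff M _ _).1 hreg').1⟩
  · rintro ⟨rs, rfl, hmem, hreg⟩
    exact length_le_localDepth hmem hreg.toIsWeaklyRegular

lemma localDepth_le_localDepth {N : Type*} [AddCommGroup N] [Module R N]
    (h : ∀ rs : List R, (∀ r ∈ rs, r ∈ maximalIdeal R) →
      IsWeaklyRegular N rs → IsWeaklyRegular M rs) : localDepth R N ≤ localDepth R M :=
  iSup_le fun ⟨rs, hmem, hreg⟩ => length_le_localDepth hmem (h rs hmem hreg.toIsWeaklyRegular)

lemma exists_isSMulRegular_of_localDepth_ne_zero (h : localDepth R M ≠ 0) :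
    ∃ x ∈ maximalIdeal R, IsSMulRegular M x := by
  obtain ⟨rs, hlen, hmem, hreg⟩ := natCast_le_localDepth_iff.1
    (by simpa using Order.one_le_iff_ne_zero.2 h : ((1 : ℕ) : ℕ∞) ≤ localDepth R M)
  obtain ⟨x, rfl⟩ := List.length_eq_one_iff.1 hlen
  exact ⟨x, by simpa using hmem, ((isRegular_cons_iff M x []).1 hreg).1⟩

end

lemma subsingleton_ext_X₃_of_shortExact {C : Type*} [Category C] [Abelian C] [HasExt C]
    {S : ShortComplex C} (hS : S.ShortExact) {X : C} {i : ℕ} (h₂ : Subsingleton (Ext X S.X₂ i))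
    (h₁ : Subsingleton (Ext X S.X₁ (i + 1))) : Subsingleton (Ext X S.X₃ i) := by
  refine subsingleton_of_forall_eq 0 fun e => ?_
  obtain ⟨e', rfl⟩ := Ext.covariant_sequence_exact₃ _ hS e rfl (Subsingleton.elim _ _)
  rw [Subsingleton.elim e' 0, Ext.zero_comp]

variable [IsNoetherianRing R]

lemma natCast_le_localDepth_iff_subsingleton_ext [Small.{v} R] {M : Type v} [AddCommGroup M]
    [Module R M] [Module.Finite R M] [Nontrivial M] {n : ℕ} :
    n ≤ localDepth R M ↔ ∀ i < n, Subsingleton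
      (Ext (ModuleCat.of R (Shrink.{v} (R ⧸ maximalIdeal R))) (ModuleCat.of R M) i) := by
  have hlt : maximalIdeal R • (⊤ : Submodule R (ModuleCat.of R M)) < ⊤ :=
    (Submodule.top_ne_ideal_smul_of_le_jacobson_annihilator
      (maximalIdeal_le_jacobson _)).symm.lt_top
  rw [natCast_le_localDepth_iff]
  exact ((ModuleCat.exists_isRegular_tfae (maximalIdeal R) n (.of R M) hlt).out 1 3).symm

lemma localDepth_le_localDepth_quotSMulTop_add_one [Small.{v} R] {M : Type v} [AddCommGroup M]
    [Module R M] [Module.Finite R M] [Nontrivial M] {x : R} (hx : x ∈ maximalIdeal R)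
    (hreg : IsSMulRegular M x) : localDepth R M ≤ localDepth R (QuotSMulTop x M) + 1 := by
  have := nontrivial_quotSMulTop_of_mem_maximalIdeal M hx
  refine ENat.forall_natCast_le_iff_le.1 fun n hn => ?_
  obtain - | n := n
  · simp
  rw [natCast_le_localDepth_iff_subsingleton_ext] at hn
  rw [Nat.cast_succ]
  gcongr
  refine natCast_le_localDepth_iff_subsingleton_ext.2 fun i hi => ?_
  exact subsingleton_ext_X₃_of_shortExact (S := (ModuleCat.of R M).smulShortComplex x)
    hreg.smulShortComplex_shortExact (hn i (by lia)) (hn (i + 1) (by lia))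

variable {M : Type v} [AddCommGroup M] [Module R M] [Module.Finite R M]

lemma localDepth_quotSMulTop_add_one [Nontrivial M] {x : R} (hx : x ∈ maximalIdeal R)
    (hreg : IsSMulRegular M x) : localDepth R (QuotSMulTop x M) + 1 = localDepth R M := by
  apply le_antisymm
  · have := nontrivial_quotSMulTop_of_mem_maximalIdeal M hx
    refine ENat.forall_natCast_le_iff_le.1 fun n hn => ?_
    obtain - | n := n
    · simp
    obtain ⟨rs, rfl, hmem, hrs⟩ := natCast_le_localDepth_iff.1
      ((ENat.add_le_add_iff_right ENat.one_ne_top).1 hn)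
    exact length_le_localDepth (rs := x :: rs) (by simpa using ⟨hx, hmem⟩)
      (.cons hreg hrs.toIsWeaklyRegular)
  · -- `ModuleCat.{v} R` has `Ext` groups only if `R` is `v`-small, so pass to `ULift M`.
    let e : ULift.{u} M ≃ₗ[R] M := ULift.moduleEquiv
    have : Small.{max v u} R := small_max _
    rw [← localDepth_congr e, ← localDepth_congr (QuotSMulTop.congr x e)]
    exact localDepth_le_localDepth_quotSMulTop_add_one hx ((e.isSMulRegular_congr x).2 hreg)

lemma exists_injective_of_localDepth_eq_zero [Nontrivial M] (h : localDepth R M = 0) :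
    ∃ f : (R ⧸ maximalIdeal R) →ₗ[R] M, Function.Injective f := by
  have : ¬ Subsingleton ((R ⧸ maximalIdeal R) →ₗ[R] M) := by
    rw [IsSMulRegular.subsingleton_linearMap_iff, Ideal.annihilator_quotient]
    rintro ⟨x, hx, hreg⟩
    simpa [h] using length_le_localDepth (rs := [x]) (by simpa using hx) (.cons hreg (.nil _ _))
  have := not_subsingleton_iff_nontrivial.1 this
  obtain ⟨f, hf⟩ := exists_ne (0 : (R ⧸ maximalIdeal R) →ₗ[R] M)
  have : IsSimpleModule R (R ⧸ maximalIdeal R) :=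
    isSimpleModule_iff_isCoatom.2 (maximalIdeal.isMaximal R).out
  exact ⟨f, LinearMap.injective_of_ne_zero hf⟩

lemma localDepth_le_ringKrullDim : (localDepth R M : WithBot ℕ∞) ≤ ringKrullDim R := by
  obtain ⟨d, hd⟩ := WithBot.ne_bot_iff_exists.1 (ringKrullDim_ne_bot (R := R))
  rw [← hd, WithBot.coe_le_coe]
  refine iSup_le fun ⟨rs, _, hreg⟩ => WithBot.coe_le_coe.1 ?_
  rw [hd]
  calc (rs.length : WithBot ℕ∞)
      ≤ Module.supportDim R (M ⧸ Ideal.ofList rs • (⊤ : Submodule R M)) + rs.length := by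
        have : Nontrivial (M ⧸ Ideal.ofList rs • (⊤ : Submodule R M)) :=
          Submodule.Quotient.nontrivial_iff.2 hreg.top_ne_smul.symm
        exact le_add_of_nonneg_left <| Order.krullDim_nonneg_iff.2
          Module.nonempty_support_of_nontrivial.to_subtype
    _ = Module.supportDim R M := Module.supportDim_add_length_eq_supportDim_of_isRegular rs hreg
    _ ≤ ringKrullDim R := Module.supportDim_le_ringKrullDim R M

lemma localDepth_ne_top : localDepth R M ≠ ⊤ := by
  intro h
  have := localDepth_le_ringKrullDim (R := R) (M := M)
  rw [h] at this
  exact ringKrullDim_ne_top (top_le_iff.1 this)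

end Depth

section LocalFlatness

open TensorProduct

variable {R S : Type*} [CommRing R] [CommRing S] [Algebra R S]
  {T : Type*} [AddCommGroup T] [Module R T] [Module S T] [IsScalarTower R S T]
  {N : Type*} [AddCommGroup N] [Module R N]

lemma finite_tensorProduct [Module.Finite S T] [Module.Finite R N] : Module.Finite S (T ⊗[R] N) :=
  .equiv (AlgebraTensorModule.cancelBaseChange R S S T N)

/-- The canonical isomorphism `(T ⊗ N) ⧸ y (T ⊗ N) ≃ (T ⧸ y T) ⊗ N`, for `y` acting on the left
factor. -/
noncomputable def quotSMulTopTensorEquiv (y : S) (T : Type*) [AddCommGroup T] [Module R T]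
    [Module S T] [IsScalarTower R S T] (N : Type*) [AddCommGroup N] [Module R N] :
    QuotSMulTop y (T ⊗[R] N) ≃ₗ[S] QuotSMulTop y T ⊗[R] N :=
  QuotSMulTop.equivQuotTensor y _ ≪≫ₗ
    (AlgebraTensorModule.assoc R S S (S ⧸ Ideal.span {y}) T N).symm ≪≫ₗ
    AlgebraTensorModule.congr (QuotSMulTop.equivQuotTensor y T).symm (.refl R N)

lemma isSMulRegular_tensorProduct_of_injective [Module.Flat R T] {N' : Type*} [AddCommGroup N']
    [Module R N'] {i : N' →ₗ[R] N} (hi : Function.Injective i) {y : S}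
    (hy : IsSMulRegular (T ⊗[R] N) y) : IsSMulRegular (T ⊗[R] N') y :=
  hy.of_injective (AlgebraTensorModule.lTensor S T i)
    (Module.Flat.lTensor_preserves_injective_linearMap i hi)

lemma isSMulRegular_tensorProduct_finsupp {y : S} (hy : IsSMulRegular (T ⊗[R] N) y) (ι : Type*) :
    IsSMulRegular (T ⊗[R] (ι →₀ N)) y := by
  classical
  rw [(TensorProduct.finsuppRight R S T N ι).isSMulRegular_congr]
  exact fun f g h => Finsupp.ext fun i => hy (DFunLike.congr_fun h i)

lemma isSMulRegular_tensorProduct_quotient_smul_top {I : Ideal R} [I.IsMaximal] {y : S}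
    (hy : IsSMulRegular (T ⊗[R] (R ⧸ I)) y) (N : Type*) [AddCommGroup N] [Module R N] :
    IsSMulRegular (T ⊗[R] (N ⧸ (I • ⊤ : Submodule R N))) y := by
  let := Ideal.Quotient.field I
  let b := Module.Basis.ofVectorSpace (R ⧸ I) (N ⧸ (I • ⊤ : Submodule R N))
  rw [(AlgebraTensorModule.congr (.refl S T) (b.repr.restrictScalars R)).isSMulRegular_congr]
  exact isSMulRegular_tensorProduct_finsupp hy _

lemma range_lTensor_subtype_smul_top_le (I : Ideal R) :
    (AlgebraTensorModule.lTensor S T (I • ⊤ : Submodule R N).subtype).range ≤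
      I.map (algebraMap R S) • (⊤ : Submodule S (T ⊗[R] N)) := by
  rintro _ ⟨u, rfl⟩
  induction u with
  | zero => simp
  | add a b ha hb => rw [map_add]; exact add_mem ha hb
  | tmul t n =>
    obtain ⟨n, hn⟩ := n
    change t ⊗ₜ n ∈ _
    refine Submodule.smul_induction_on hn (fun r hr n _ => ?_) (fun a b ha hb => ?_)
    · rw [tmul_smul, ← algebraMap_smul S r]
      exact Submodule.smul_mem_smul (Ideal.mem_map_of_mem _ hr) trivial
    · rw [tmul_add]
      exact add_mem ha hb

lemma mem_pow_smul_top_of_smul_eq_zero [Module.Flat R T] {I : Ideal R} [I.IsMaximal] {y : S}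
    (hy : IsSMulRegular (T ⊗[R] (R ⧸ I)) y) (j : ℕ) {N : Type*} [AddCommGroup N] [Module R N]
    (z : T ⊗[R] N) (hz : y • z = 0) :
    z ∈ ((I.map (algebraMap R S)) ^ j • ⊤ : Submodule S (T ⊗[R] N)) := by
  induction j generalizing N with
  | zero => simp
  | succ j ih =>
    have hz_quot : AlgebraTensorModule.lTensor S T (I • ⊤ : Submodule R N).mkQ z = 0 := by
      apply (isSMulRegular_tensorProduct_quotient_smul_top hy N).right_eq_zero_of_smul
      rw [← map_smul, hz, map_zero]
    let F := AlgebraTensorModule.lTensor S T (I • ⊤ : Submodule R N).subtype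
    have hF : Function.Injective F :=
      Module.Flat.lTensor_preserves_injective_linearMap _ (Submodule.injective_subtype _)
    obtain ⟨w, rfl⟩ : ∃ w, F w = z :=
      (lTensor_exact T (LinearMap.exact_subtype_mkQ _) (Submodule.mkQ_surjective _) z).1 hz_quot
    have hw : y • w = 0 := hF (by rw [map_smul, hz, map_zero])
    rw [pow_succ, Submodule.mul_smul]
    refine smul_mono_right _ (range_lTensor_subtype_smul_top_le I) ?_
    rw [LinearMap.range_eq_map, ← Submodule.map_smul'']
    exact Submodule.mem_map_of_mem (ih w hw)

lemma rTensor_lsmul_restrictScalars (y : S) (u : T ⊗[R] N) :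
    ((LinearMap.lsmul S T y).restrictScalars R).rTensor N u = y • u := by
  induction u with
  | zero => simp
  | add a b ha hb => rw [map_add, ha, hb, smul_add]
  | tmul t p => rfl

-- The hypothesis makes multiplication by `y` on `T` injective modulo every ideal, so that
-- `y T ∩ I T = y I T`, which is the vanishing of `Tor₁(T ⧸ y T, R ⧸ I)`.
lemma flat_quotSMulTop [Module.Flat R T] {y : S}
    (hy : ∀ I : Ideal R, IsSMulRegular (T ⊗[R] (R ⧸ I)) y) :
    Module.Flat R (QuotSMulTop y T) := by
  let q : T →ₗ[R] QuotSMulTop y T :=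
    LinearMap.restrictScalars R (Submodule.mkQ (y • (⊤ : Submodule S T)))
  have hq : Function.Surjective q := Submodule.mkQ_surjective (y • (⊤ : Submodule S T))
  have hex : Function.Exact ((LinearMap.lsmul S T y).restrictScalars R) q :=
    LinearMap.exact_lsmul_mkQ_smul_top T y
  rw [Module.Flat.iff_lTensor_injective]
  intro I _
  rw [injective_iff_map_eq_zero]
  intro z hz
  obtain ⟨a, rfl⟩ := LinearMap.rTensor_surjective I hq z
  rw [← LinearMap.comp_apply, LinearMap.lTensor_comp_rTensor, ← LinearMap.rTensor_comp_lTensor,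
    LinearMap.comp_apply] at hz
  obtain ⟨c, hc⟩ := (rTensor_exact R hex hq _).1 hz
  rw [rTensor_lsmul_restrictScalars] at hc
  have hI := lTensor_exact T (LinearMap.exact_subtype_mkQ I) (Submodule.mkQ_surjective _)
  have hc_quot : AlgebraTensorModule.lTensor S T (Submodule.mkQ I) c = 0 := by
    apply (hy I).right_eq_zero_of_smul
    rw [← map_smul, hc]
    exact (hI _).2 ⟨a, rfl⟩
  obtain ⟨c', rfl⟩ := (hI c).1 hc_quot
  have ha : y • c' = a :=
    Module.Flat.lTensor_preserves_injective_linearMap I.subtype (Submodule.injective_subtype _) <|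
      (map_smul (AlgebraTensorModule.lTensor S T I.subtype) y c').trans hc
  rw [← ha, ← rTensor_lsmul_restrictScalars]
  exact (rTensor_exact I hex hq _).2 ⟨c', rfl⟩

variable [IsLocalRing R] [IsLocalRing S] [IsNoetherianRing S] [IsLocalHom (algebraMap R S)]
  [Module.Finite S T] [Module.Flat R T]

lemma isSMulRegular_tensorProduct_of_residue [Module.Finite R N] {y : S}
    (hy : IsSMulRegular (T ⊗[R] (R ⧸ maximalIdeal R)) y) : IsSMulRegular (T ⊗[R] N) y := by
  refine .of_right_eq_zero_of_smul fun z hz => ?_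
  have : Module.Finite S (T ⊗[R] N) := finite_tensorProduct
  have hle : (maximalIdeal R).map (algebraMap R S) ≤ maximalIdeal S :=
    ((local_hom_TFAE (algebraMap R S)).out 0 2 rfl rfl).1 ‹_›
  have hbot := Ideal.iInf_pow_smul_eq_bot_of_isLocalRing (M := T ⊗[R] N) _
    (ne_top_of_le_ne_top (maximalIdeal.isMaximal S).ne_top hle)
  rw [← Submodule.mem_bot S, ← hbot, Submodule.mem_iInf]
  exact fun j => mem_pow_smul_top_of_smul_eq_zero hy j z hz

lemma isWeaklyRegular_tensorProduct_of_residue [Module.Finite R N] {rs : List S}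
    (h : IsWeaklyRegular (T ⊗[R] (R ⧸ maximalIdeal R)) rs) : IsWeaklyRegular (T ⊗[R] N) rs := by
  induction rs generalizing T with
  | nil => exact .nil S _
  | cons y rs ih =>
    rw [isWeaklyRegular_cons_iff] at h
    have : Module.Flat R (QuotSMulTop y T) :=
      flat_quotSMulTop fun I => isSMulRegular_tensorProduct_of_residue h.1
    exact .cons (isSMulRegular_tensorProduct_of_residue h.1) <|
      ((quotSMulTopTensorEquiv y T N).isWeaklyRegular_congr rs).2 <|
        ih (((quotSMulTopTensorEquiv y T _).isWeaklyRegular_congr rs).1 h.2)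

lemma isWeaklyRegular_tensorProduct_residue_of_injective
    {i : (R ⧸ maximalIdeal R) →ₗ[R] N} (hi : Function.Injective i) {rs : List S}
    (h : IsWeaklyRegular (T ⊗[R] N) rs) : IsWeaklyRegular (T ⊗[R] (R ⧸ maximalIdeal R)) rs := by
  induction rs generalizing T with
  | nil => exact .nil S _
  | cons y rs ih =>
    rw [isWeaklyRegular_cons_iff] at h
    have hy := isSMulRegular_tensorProduct_of_injective hi h.1
    have : Module.Flat R (QuotSMulTop y T) :=
      flat_quotSMulTop fun I => isSMulRegular_tensorProduct_of_residue hy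
    exact .cons hy <| ((quotSMulTopTensorEquiv y T _).isWeaklyRegular_congr rs).2 <|
      ih (((quotSMulTopTensorEquiv y T N).isWeaklyRegular_congr rs).1 h.2)

end LocalFlatness

section BaseChange

open TensorProduct

variable {R S : Type*} [CommRing R] [CommRing S] [Algebra R S] [Module.FaithfullyFlat R S]
  {M : Type*} [AddCommGroup M] [Module R M]

theorem localDepth_baseChange [IsLocalRing R] [IsLocalRing S] [IsNoetherianRing R]
    [IsNoetherianRing S] [Module.Finite R M] [Nontrivial M] :
    localDepth S (S ⊗[R] M) =
      localDepth R M + localDepth S (S ⊗[R] (R ⧸ maximalIdeal R)) := by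
  obtain ⟨n, hn⟩ := ENat.ne_top_iff_exists.1 (localDepth_ne_top (R := R) (M := M))
  induction n generalizing M with
  | zero =>
    obtain ⟨i, hi⟩ := exists_injective_of_localDepth_eq_zero hn.symm
    rw [← hn, Nat.cast_zero, zero_add]
    exact le_antisymm
      (localDepth_le_localDepth fun rs _ => isWeaklyRegular_tensorProduct_residue_of_injective hi)
      (localDepth_le_localDepth fun rs _ => isWeaklyRegular_tensorProduct_of_residue)
  | succ n ih =>
    obtain ⟨x, hx, hreg⟩ : ∃ x ∈ maximalIdeal R, IsSMulRegular M x :=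
      exists_isSMulRegular_of_localDepth_ne_zero (by simp [← hn])
    have := nontrivial_quotSMulTop_of_mem_maximalIdeal M hx
    have hdepth := localDepth_quotSMulTop_add_one hx hreg
    have hxS : algebraMap R S x ∈ maximalIdeal S :=
      map_maximalIdeal_le _ (Ideal.mem_map_of_mem _ hx)
    have hregS : IsSMulRegular (S ⊗[R] M) (algebraMap R S x) :=
      hreg.of_flat_of_isBaseChange (TensorProduct.isBaseChange R M S)
    have hn' : n = localDepth R (QuotSMulTop x M) :=
      ENat.add_left_injective_of_ne_top ENat.one_ne_top (hn.trans hdepth.symm)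
    rw [← localDepth_quotSMulTop_add_one hxS hregS, ← hdepth,
      localDepth_congr (QuotSMulTop.algebraMapTensorEquivTensorQuotSMulTop x M S), ih hn',
      add_right_comm]

lemma isMCM_iff [IsCMLocalRing R] :
    IsMCM R M ↔ Module.Finite R M ∧ (Subsingleton M ∨ localDepth R M = localDepth R R) := by
  rw [IsMCM, ← IsCMLocalRing.depth_eq_dim, WithBot.coe_inj]

lemma isMCM_congr [IsLocalRing R] {N : Type*} [AddCommGroup N] [Module R N] (e : M ≃ₗ[R] N) :
    IsMCM R M ↔ IsMCM R N := by
  rw [IsMCM, IsMCM, localDepth_congr e, Module.Finite.equiv_iff e, e.toEquiv.subsingleton_congr]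

theorem isMCM_baseChange_iff [IsCMLocalRing R] [IsCMLocalRing S] :
    IsMCM S (S ⊗[R] M) ↔ IsMCM R M := by
  have hfin : Module.Finite S (S ⊗[R] M) ↔ Module.Finite R M :=
    ⟨fun _ => .of_finite_tensorProduct_of_faithfullyFlat S, fun _ => inferInstance⟩
  rw [isMCM_iff, isMCM_iff, hfin]
  refine and_congr_right fun _ => ?_
  cases subsingleton_or_nontrivial M
  · simp only [‹Subsingleton M›, true_or, iff_true]
    exact .inl inferInstance
  have hself := localDepth_baseChange (R := R) (S := S) (M := R)
  rw [localDepth_congr (AlgebraTensorModule.rid R S S)] at hself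
  have htop : localDepth S (S ⊗[R] (R ⧸ maximalIdeal R)) ≠ ⊤ := localDepth_ne_top
  simp only [not_subsingleton, false_or, localDepth_baseChange (S := S) (M := M), hself]
  exact (ENat.add_left_injective_of_ne_top htop).eq_iff

end BaseChange

section FreeSummand

open TensorProduct

variable {R : Type*} [CommRing R] {M : Type*} [AddCommGroup M] [Module R M]

lemma HasNonzeroFreeSummand.exists_surjective_dual (h : HasNonzeroFreeSummand R M) :
    ∃ φ : Module.Dual R M, Function.Surjective φ := by
  obtain ⟨P, Q, hPQ, hP, hfree⟩ := h
  have := Submodule.nontrivial_iff_ne_bot.2 hP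
  let b := Module.Free.chooseBasis R P
  obtain ⟨i⟩ := b.index_nonempty
  exact ⟨b.coord i ∘ₗ P.projectionOnto Q hPQ, fun r => ⟨r • b i, by simp⟩⟩

lemma hasNonzeroFreeSummand_of_surjective_dual [Nontrivial R] {φ : Module.Dual R M}
    (hφ : Function.Surjective φ) : HasNonzeroFreeSummand R M := by
  obtain ⟨v, hv⟩ := hφ 1
  let σ : R →ₗ[R] M := .toSpanSingleton R M v
  have hσ : φ ∘ₗ σ = .id := LinearMap.ext_ring (by simp [σ, hv])
  have hinj : Function.Injective σ := Function.LeftInverse.injective (LinearMap.congr_fun hσ)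
  have hproj : IsIdempotentElem (σ ∘ₗ φ) := by
    rw [IsIdempotentElem, Module.End.mul_eq_comp, LinearMap.comp_assoc, ← φ.comp_assoc, hσ,
      LinearMap.id_comp]
  have hcompl := LinearMap.IsIdempotentElem.isCompl hproj
  rw [LinearMap.range_comp_of_range_eq_top _ (LinearMap.range_eq_top.2 hφ),
    LinearMap.ker_comp_of_ker_eq_bot _ (LinearMap.ker_eq_bot.2 hinj)] at hcompl
  have := hinj.nontrivial
  refine ⟨σ.range, φ.ker, hcompl, ?_, .of_equiv (.ofInjective σ hinj)⟩
  exact Submodule.nontrivial_iff_ne_bot.1 (LinearEquiv.ofInjective σ hinj).symm.toEquiv.nontrivial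

lemma hasNonzeroFreeSummand_iff [Nontrivial R] :
    HasNonzeroFreeSummand R M ↔ ∃ φ : Module.Dual R M, Function.Surjective φ :=
  ⟨fun h => h.exists_surjective_dual, fun ⟨_, hφ⟩ => hasNonzeroFreeSummand_of_surjective_dual hφ⟩

lemma not_surjective_dual_iff [IsLocalRing R] {φ : Module.Dual R M} :
    ¬ Function.Surjective φ ↔ ∀ v, φ v ∈ maximalIdeal R := by
  rw [← LinearMap.range_eq_top]
  refine ⟨fun h v => le_maximalIdeal h (LinearMap.mem_range_self φ v), fun h htop => ?_⟩
  obtain ⟨v, hv⟩ := LinearMap.range_eq_top.1 htop 1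
  exact (maximalIdeal.isMaximal R).ne_top ((Ideal.eq_top_iff_one _).2 (hv ▸ h v))

variable {S : Type*} [CommRing S] [Algebra R S]

lemma span_range_dualBaseChange [Module.Flat R S] [Module.FinitePresentation R M] :
    Submodule.span S (Set.range (Module.Dual.baseChange S (R := R) (V := M))) = ⊤ := by
  refine Submodule.eq_top_iff'.2 fun ψ => ?_
  let e : (S ⊗[R] M →ₗ[S] S ⊗[R] R) →ₗ[S] Module.Dual S (S ⊗[R] M) :=
    (AlgebraTensorModule.rid R S S).toLinearMap.compRight S
  suffices h : ∀ f, e f ∈ Submodule.span S (Set.range (Module.Dual.baseChange S)) by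
    convert h ((AlgebraTensorModule.rid R S S).symm ∘ₗ ψ)
    ext; simp [e]
  intro f
  induction f using (Module.FinitePresentation.isBaseChange_map R M R S).inductionOn with
  | zero => simp
  | tmul φ => exact Submodule.subset_span ⟨φ, rfl⟩
  | smul s f hf => rw [map_smul]; exact Submodule.smul_mem _ s hf
  | add f g hf hg => rw [map_add]; exact add_mem hf hg

theorem hasNonzeroFreeSummand_baseChange_iff [IsLocalRing R] [IsLocalRing S]
    [Module.Flat R S] [IsLocalHom (algebraMap R S)] [Module.FinitePresentation R M] :
    HasNonzeroFreeSummand S (S ⊗[R] M) ↔ HasNonzeroFreeSummand R M := by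
  rw [hasNonzeroFreeSummand_iff, hasNonzeroFreeSummand_iff]
  constructor
  · contrapose!
    intro h ψ
    rw [not_surjective_dual_iff]
    have hψ : ψ ∈ Submodule.span S (Set.range (Module.Dual.baseChange S (R := R) (V := M))) :=
      by rw [span_range_dualBaseChange]; trivial
    induction hψ using Submodule.span_induction with
    | zero => simp
    | add ψ₁ ψ₂ _ _ h₁ h₂ => exact fun z => add_mem (h₁ z) (h₂ z)
    | smul s ψ _ hψ => exact fun z => Ideal.mul_mem_left _ s (hψ z)
    | mem _ hφ =>
      obtain ⟨φ, rfl⟩ := hφ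
      intro z
      induction z with
      | zero => simp
      | add z₁ z₂ h₁ h₂ => rw [map_add]; exact add_mem h₁ h₂
      | tmul s v =>
        rw [Module.Dual.baseChange_apply_tmul, Algebra.smul_def]
        exact Ideal.mul_mem_right _ _ <| map_maximalIdeal_le _ <|
          Ideal.mem_map_of_mem _ (not_surjective_dual_iff.1 (h φ) v)
  · rintro ⟨φ, hφ⟩
    obtain ⟨v, hv⟩ := hφ 1
    exact ⟨φ.baseChange S, fun s => ⟨s ⊗ₜ v, by simp [hv]⟩⟩

end FreeSummand

section Syzygy

lemma subsingleton_ext_X₃_of_hom {C : Type*} [Category C] [Abelian C] [HasExt C]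
    {S₁ S₂ : ShortComplex C} (hS₁ : S₁.ShortExact) (hS₂ : S₂.ShortExact) (τ : S₁ ⟶ S₂)
    [IsSplitMono τ.τ₁] {X : C} {i : ℕ} (h₁ : Subsingleton (Ext X S₁.X₂ i))
    (h₂ : Subsingleton (Ext X S₂.X₃ i)) : Subsingleton (Ext X S₁.X₃ i) := by
  -- The image of `e` in `Ext X S₂.X₁ (i + 1)` dies in `Ext X S₂.X₂ (i + 1)`, so comes from
  -- `Ext X S₂.X₃ i = 0`.
  refine subsingleton_of_forall_eq 0 fun e => ?_
  have hτ : (e.comp hS₁.extClass rfl).comp (Ext.mk₀ τ.τ₁) (add_zero _) = 0 := by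
    obtain ⟨e', he'⟩ := Ext.covariant_sequence_exact₁ X hS₂
      ((e.comp hS₁.extClass rfl).comp (Ext.mk₀ τ.τ₁) (add_zero _))
      (by simp only [Ext.comp_assoc_of_third_deg_zero, Ext.mk₀_comp_mk₀, τ.comm₁₂]
          simp [← Ext.mk₀_comp_mk₀]) rfl
    rw [← he', Subsingleton.elim e' 0, Ext.zero_comp]
  have he : e.comp hS₁.extClass rfl = 0 := by
    have := congr_arg (Ext.comp · (Ext.mk₀ (retraction τ.τ₁)) (add_zero _)) hτ
    simpa using this
  obtain ⟨e', rfl⟩ := Ext.covariant_sequence_exact₃ X hS₁ e rfl he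
  rw [Subsingleton.elim e' 0, Ext.zero_comp]

lemma exists_comp_pi_eq {R M ι : Type*} [CommRing R] [AddCommGroup M] [Module R M] [Finite ι]
    {s : ι → Module.Dual R M} (hs : Submodule.span R (Set.range s) = ⊤) {κ : Type*}
    (i : M →ₗ[R] (κ → R)) : ∃ g : (ι → R) →ₗ[R] (κ → R), g ∘ₗ .pi s = i := by
  have := Fintype.ofFinite ι
  have h (k) : ∃ c : ι → R, ∑ j, c j • s j = .proj k ∘ₗ i :=
    (Submodule.mem_span_range_iff_exists_fun R).1 (hs ▸ Submodule.mem_top)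
  choose c hc using h
  refine ⟨Matrix.mulVecLin (.of c), ?_⟩
  ext v k
  simpa [Matrix.mulVec, dotProduct] using LinearMap.congr_fun (hc k) v

variable {R : Type u} [CommRing R] [IsCMLocalRing R]

lemma localDepth_le_localDepth_self (M : Type*) [AddCommGroup M] [Module R M]
    [Module.Finite R M] : localDepth R M ≤ localDepth R R :=
  WithBot.coe_le_coe.1 (localDepth_le_ringKrullDim.trans_eq IsCMLocalRing.depth_eq_dim.symm)

lemma isMCM_of_flat (M : Type*) [AddCommGroup M] [Module R M] [Module.Finite R M]
    [Module.Flat R M] : IsMCM R M := by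
  obtain hM | hM := subsingleton_or_nontrivial M
  · exact ⟨inferInstance, .inl hM⟩
  refine isMCM_iff.2 ⟨inferInstance, .inr ?_⟩
  refine le_antisymm (localDepth_le_localDepth_self M) (localDepth_le_localDepth fun rs _ h => ?_)
  exact ((TensorProduct.rid R M).isWeaklyRegular_congr rs).1 (h.isWeaklyRegular_lTensor)

lemma isMCM_iff_subsingleton_ext {M : Type u} [AddCommGroup M] [Module R M] :
    IsMCM R M ↔ Module.Finite R M ∧ ∀ i : ℕ, i < localDepth R R → Subsingleton
      (Ext (ModuleCat.of R (Shrink.{u} (R ⧸ maximalIdeal R))) (ModuleCat.of R M) i) := by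
  rw [isMCM_iff]
  refine and_congr_right fun _ => ?_
  cases subsingleton_or_nontrivial M
  · simp only [‹Subsingleton M›, true_or, true_iff]
    refine fun i _ => subsingleton_of_forall_eq 0 fun e => ?_
    have hzero := ModuleCat.isZero_of_subsingleton (.of R M)
    rw [← e.comp_mk₀_id, hzero.eq_of_tgt (𝟙 _) 0, Ext.mk₀_zero, Ext.comp_zero]
  simp only [not_subsingleton, false_or]
  rw [← (localDepth_le_localDepth_self M).ge_iff_eq, ← ENat.forall_natCast_le_iff_le]
  simp only [natCast_le_localDepth_iff_subsingleton_ext (M := M)]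
  exact ⟨fun h i hi => h (i + 1) (Order.add_one_le_of_lt hi) i (by lia),
    fun h n hn i hi => h i ((Nat.cast_lt.2 hi).trans_le hn)⟩

lemma IsMCM.quotient_of_map {F G : Type u} [AddCommGroup F] [Module R F] [AddCommGroup G]
    [Module R G] (hF : IsMCM R F) {L : Submodule R F} {g : F →ₗ[R] G}
    (hg : Function.Injective (g ∘ₗ L.subtype)) (hG : IsMCM R (G ⧸ L.map g)) :
    IsMCM R (F ⧸ L) := by
  rw [isMCM_iff_subsingleton_ext] at hF hG ⊢
  have := hF.1
  refine ⟨inferInstance, fun i hi => ?_⟩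
  have hexact₁ : Function.Exact L.subtype L.mkQ := LinearMap.exact_subtype_mkQ L
  have hexact₂ : Function.Exact (g ∘ₗ L.subtype) (L.map g).mkQ :=
    LinearMap.exact_iff.2 (by simp [LinearMap.range_comp])
  let S₁ := ModuleCat.shortComplexOfCompEqZero L.subtype L.mkQ hexact₁.linearMap_comp_eq_zero
  let S₂ := ModuleCat.shortComplexOfCompEqZero (g ∘ₗ L.subtype) (L.map g).mkQ
    hexact₂.linearMap_comp_eq_zero
  let τ : S₁ ⟶ S₂ :=
    { τ₁ := 𝟙 _
      τ₂ := ModuleCat.ofHom g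
      τ₃ := ModuleCat.ofHom (L.mapQ (L.map g) g (L.le_comap_map g)) }
  have : IsSplitMono τ.τ₁ := inferInstanceAs (IsSplitMono (𝟙 _))
  exact subsingleton_ext_X₃_of_hom
    (ModuleCat.shortComplex_shortExact S₁ hexact₁ L.injective_subtype L.mkQ_surjective)
    (ModuleCat.shortComplex_shortExact S₂ hexact₂ hg (L.map g).mkQ_surjective) τ
    (hF.2 i hi) (hG.2 i hi)

theorem isSyzygyOfMCM_iff {M : Type*} [AddCommGroup M] [Module R M] {n : ℕ}
    {s : Fin n → Module.Dual R M} (hs : Submodule.span R (Set.range s) = ⊤) :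
    IsSyzygyOfMCM R M ↔ IsMCM R M ∧ Function.Injective (LinearMap.pi s) ∧
      IsMCM R ((Fin n → R) ⧸ (LinearMap.pi s).range) := by
  refine and_congr_right fun _ => ⟨?_, fun ⟨hinj, hcoker⟩ => ?_⟩
  · rintro ⟨m, N, _, _, p, hN, hp, ⟨e⟩⟩
    let i : M →ₗ[R] (Fin m → R) := p.ker.subtype ∘ₗ e
    have hi : Function.Injective i := p.ker.injective_subtype.comp e.injective
    obtain ⟨g, hg⟩ := exists_comp_pi_eq hs i
    have hinj : Function.Injective (LinearMap.pi s) := by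
      refine Function.Injective.of_comp (f := g) ?_
      rwa [← LinearMap.coe_comp, hg]
    have hrange : (LinearMap.pi s).range.map g = p.ker := by
      rw [← LinearMap.range_comp, hg, LinearMap.range_comp_of_range_eq_top _ e.range,
        Submodule.range_subtype]
    refine ⟨hinj, (isMCM_of_flat _).quotient_of_map (g := g) ?_ ?_⟩
    · rintro ⟨_, v, rfl⟩ ⟨_, w, rfl⟩ h
      have : i v = i w := by simpa [← hg] using h
      rw [hi this]
    · rw [hrange]
      exact (isMCM_congr (p.quotKerEquivOfSurjective hp)).2 hN
  · exact ⟨n, _, inferInstance, inferInstance, (LinearMap.pi s).range.mkQ, hcoker,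
      Submodule.mkQ_surjective _,
      ⟨.ofInjective _ hinj ≪≫ₗ .ofEq _ _ (Submodule.ker_mkQ _).symm⟩⟩

end Syzygy

section SyzygyBaseChange

open TensorProduct

variable {R S : Type*} [CommRing R] [CommRing S] [Algebra R S]
  {M : Type*} [AddCommGroup M] [Module R M] {ι : Type*}

lemma span_range_baseChange_eq_top [Module.Flat R S] [Module.FinitePresentation R M]
    {s : ι → Module.Dual R M} (hs : Submodule.span R (Set.range s) = ⊤) :
    Submodule.span S (Set.range fun j => (s j).baseChange S) = ⊤ := by
  rw [eq_top_iff, ← span_range_dualBaseChange (R := R), Submodule.span_le]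
  rintro _ ⟨φ, rfl⟩
  have hφ : φ ∈ Submodule.span R (Set.range s) := hs ▸ Submodule.mem_top
  have := Submodule.mem_map_of_mem (f := Module.Dual.baseChange S) hφ
  rw [Submodule.map_span, ← Set.range_comp] at this
  exact Submodule.span_le_restrictScalars R S _ this

variable (s : ι → Module.Dual R M)

lemma pi_baseChange [Fintype ι] [DecidableEq ι] :
    LinearMap.pi (fun j => (s j).baseChange S) =
      (piScalarRight R S S ι).toLinearMap ∘ₗ (LinearMap.pi s).baseChange S := by
  ext
  simp

lemma injective_pi_baseChange_iff [Finite ι] [Module.FaithfullyFlat R S] :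
    Function.Injective (LinearMap.pi fun j => (s j).baseChange S) ↔
      Function.Injective (LinearMap.pi s) := by
  classical
  have := Fintype.ofFinite ι
  rw [pi_baseChange, LinearMap.coe_comp]
  exact (piScalarRight R S S ι).injective.of_comp_iff _ |>.trans <|
    Module.FaithfullyFlat.lTensor_injective_iff_injective R S _

lemma isMCM_quotient_range_pi_baseChange_iff [Finite ι] [IsCMLocalRing R] [IsCMLocalRing S]
    [Module.FaithfullyFlat R S] :
    IsMCM S ((ι → S) ⧸ (LinearMap.pi fun j => (s j).baseChange S).range) ↔
      IsMCM R ((ι → R) ⧸ (LinearMap.pi s).range) := by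
  classical
  have := Fintype.ofFinite ι
  let q := (LinearMap.pi s).range.mkQ
  have hq : Function.Surjective q := Submodule.mkQ_surjective _
  have hexact : Function.Exact ((LinearMap.pi s).baseChange S) (q.baseChange S) :=
    lTensor_exact S (LinearMap.pi s).exact_map_mkQ_range hq
  let e := hexact.linearEquivOfSurjective (LinearMap.lTensor_surjective S hq)
  have hrange : ((LinearMap.pi s).baseChange S).range.map (piScalarRight R S S ι).toLinearMap =
      (LinearMap.pi fun j => (s j).baseChange S).range := by
    rw [pi_baseChange, LinearMap.range_comp]
  rw [← isMCM_congr (Submodule.Quotient.equiv _ _ (piScalarRight R S S ι) hrange),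
    isMCM_congr e, isMCM_baseChange_iff]

theorem isSyzygyOfMCM_baseChange_iff [IsCMLocalRing R] [IsCMLocalRing S]
    [Module.FaithfullyFlat R S] [Module.Finite R M] :
    IsSyzygyOfMCM S (S ⊗[R] M) ↔ IsSyzygyOfMCM R M := by
  obtain ⟨n, s, hs⟩ := Module.Finite.exists_fin (R := R) (M := Module.Dual R M)
  have := Module.finitePresentation_of_finite R M
  rw [isSyzygyOfMCM_iff hs, isSyzygyOfMCM_iff (span_range_baseChange_eq_top hs),
    isMCM_baseChange_iff, injective_pi_baseChange_iff, isMCM_quotient_range_pi_baseChange_iff]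

end SyzygyBaseChange

theorem corollary3p4_general {R S M : Type*} [CommRing R] [IsCMLocalRing R] [CommRing S]
    [IsCMLocalRing S] [Algebra R S] [Module.FaithfullyFlat R S] [AddCommGroup M] [Module R M] :
    IsOCMS R M ↔ IsOCMS S (TensorProduct R S M) := by
  by_cases hM : Module.Finite R M
  · have := Module.finitePresentation_of_finite R M
    rw [IsOCMS, IsOCMS, isSyzygyOfMCM_baseChange_iff, hasNonzeroFreeSummand_baseChange_iff]
  · exact iff_of_false (fun h => hM h.1.1.1) fun h =>
      have := h.1.1.1
      hM (.of_finite_tensorProduct_of_faithfullyFlat S)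

theorem corollary3p4 {R S M : Type*} [CommRing R] [IsCMLocalRing R] [CommRing S] [IsCMLocalRing S]
    [Algebra R S] [Module.FaithfullyFlat R S] [AddCommGroup M] [Module R M] (hM : IsMCM R M) :
    IsOCMS R M ↔ IsOCMS S (TensorProduct R S M) :=
  corollary3p4_general
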